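/- **Conventions.** Write $\mathbf 1=\{0\}$ and $\mathbf 2^X$ for the power set of $X$. A *diagram* $(\mathcal S,\mathcal S',\mathcal M)$ consists of an indexed family $\mathcal S$ of sets (the same set may occur several times), a subfamily $\mathcal S'\subset\mathcal S$, and an indexed family $\mathcal M$ of maps $\varphi:\mathbf 2^{S}\to\mathbf 2^{T}$ with $S,T\in\mathcal S$; it is *finite* if $\mathcal S$ and $\mathcal M$ are finite. A *cross section* of the diagram assigns to each $S\in\mathcal S$ a subset $s(S)\subset S$ such that, for every $T\in\mathcal S$ that is the target of at least one map of $\mathcal M$, $s(T)=\bigcap_{\varphi}\varphi(s(\mathrm{dm}\,\varphi))$ if $T\notin\mathcal S'$ and $s(T)=\bigcup_{\varphi}\varphi(s(\mathrm{dm}\,\varphi))$ if $T\in\mathcal S'$, where $\varphi:\mathbf 2^{\mathrm{dm}\,\varphi}\to\mathbf 2^{T}$ ranges over the maps in $\mathcal M$ with target $T$. Let $\mathcal M_{\mathbb N}=\{0,\mathrm{succ}\}$ with the constant map $0:\mathbf 1\to\mathbb N$ and the successor map $\mathrm{succ}:\mathbb N\to\mathbb N$, and let $\langle\mathcal M_{\mathbb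 N}\rangle$ be the smallest class of maps that contains $\mathcal M_{\mathbb N}$, all identity maps, all maps $X\to\mathbf 1$ and all projections of finite Cartesian products, and is closed under composition and under product maps $x\mapsto(f_1(x),\dots,f_n(x))$. A diagram is *generated by* $\mathcal M_{\mathbb N}$ if each of its maps is the direct image map $\mathbf 2^X\to\mathbf 2^Y$ or the inverse image map $\mathbf 2^Y\to\mathbf 2^X$ of some map $f:X\to Y$ in $\langle\mathcal M_{\mathbb N}\rangle$. A *Turing machine with binary alphabet* is $M=(Q,\{0,1\},\Theta,\sqcup,\delta,q_0,q_{\mathrm A},q_{\mathrm R})$ with finite sets $Q$ of states and $\Theta\supset\{0,1\}$ of tape symbols, a blank $\sqcup\in\Theta\setminus\{0,1\}$, a transition function $\delta:\Theta\times Q\to\Theta\times Q\times\{0,1\}$ (new symbol, new state, move: $0$ is left, $1$ is right), and $q_0,q_{\mathrm A},q_{\mathrm R}\in Q$ with $q_{\mathrm A}\ne q_{\mathrm R}$. It works on a tape with cells $0,1,2,\dots$, starting in state $q_0$ at cell $0$ with the input string followed by blanks on the tape; a left move at cell $0$ leaves the head there; it stops, accepting or rejecting, when it reaches $q_{\mathrm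 A}$ or $q_{\mathrm R}$, respectively. It *accepts $\sigma$ leaving $\tau$* if it accepts $\sigma$ and its tape then holds the binary string $\tau$ from cell $0$ on, followed only by blanks. For a binary string $\sigma=\sigma[0]\cdots\sigma[|\sigma|-1]$ put $$\bar\sigma=\{(i,\sigma[i])\mid 0\le i<|\sigma|\}\cup\{(|\sigma|,0),(|\sigma|,1)\}\subset\mathbb N\times\mathbb N .$$ **Theorem.** Let $M$ be a Turing machine with binary alphabet. Then there are a finite diagram $(\mathcal S,\mathcal S',\mathcal M)$ generated by $\mathcal M_{\mathbb N}$, a member $\mathbf 1$ of $\mathcal S$, two different members $S=\mathbb N\times\mathbb N$ and $T=\mathbb N\times\mathbb N$ of $\mathcal S$, and a map $\bar M:\mathbf 2^{\mathbb N\times\mathbb N}\to\mathbf 2^{\mathbb N\times\mathbb N}$ such that 1. for all binary strings $\sigma$ and $\tau$: if $M$ accepts $\sigma$ leaving $\tau$, then $\bar M(\bar\sigma)=\bar\tau$; and if $M$ rejects $\sigma$ or does not terminate with input $\sigma$, then $\bar M(\bar\sigma)=\emptyset$; 2. the diagram, with the full set prescribed on that member $\mathbf 1$, represents $\bar M$ from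 $S$ to $T$: every cross section $s$ of the diagram with $s(\mathbf 1)=\mathbf 1$ satisfies $s(T)=\bar M(s(S))$; 3. every input occurs: for every $A\subset\mathbb N\times\mathbb N$ there is a cross section $s$ of the diagram with $s(\mathbf 1)=\mathbf 1$ and $s(S)=A$. -/

import Mathlib

/-! ### Diagrams and their cross sections -/

/-- A diagram: a family of sets `carrier S` (indexed by `Index`, so that equal sets may occur
several times), a subfamily `unionPart`, and a family of maps between power sets of members of the
family. The maps with domain `2^S` and codomain `2^T` are indexed by `Arrow S T`. -/
structure Diagram where
  Index : Type
  carrier : Index → Type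
  unionPart : Set Index
  Arrow : Index → Index → Type
  map : ∀ {S T : Index}, Arrow S T → Set (carrier S) → Set (carrier T)

namespace Diagram

/-- Both the family of sets and the family of maps are finite. -/
def IsFinite (D : Diagram) : Prop :=
  Finite D.Index ∧ Finite (Σ S T : D.Index, D.Arrow S T)

/-- A cross section of the family of sets: a subset of every member. -/
abbrev Section (D : Diagram) : Type :=
  ∀ S : D.Index, Set (D.carrier S)

/-- A cross section of a subfamily. -/
abbrev PartialSection (D : Diagram) (F : Set D.Index) : Type :=
  ∀ S : F, Set (D.carrier S)

/-- A cross section of the diagram: on every set with at least one incoming map, it is the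
intersection of the images by the incoming maps, or their union if the set is in `unionPart`. -/
def IsCrossSection (D : Diagram) (s : D.Section) : Prop :=
  ∀ T : D.Index, (∃ S : D.Index, Nonempty (D.Arrow S T)) →
    (T ∉ D.unionPart → s T = ⋂ (S : D.Index) (φ : D.Arrow S T), D.map φ (s S)) ∧
    (T ∈ D.unionPart → s T = ⋃ (S : D.Index) (φ : D.Arrow S T), D.map φ (s S))

/-- The cross sections of the diagram that restrict to `t` on the subfamily `F`. -/
def crossSections (D : Diagram) (F : Set D.Index) (t : D.PartialSection F) : Set D.Section :=
  {s | D.IsCrossSection s ∧ ∀ S : F, s S = t S}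

/-- The data `(D, F, t, X, Y)` represents the map `φ : 2^X → 2^Y`. -/
def RepresentsMap (D : Diagram) (F : Set D.Index) (t : D.PartialSection F) (X Y : D.Index)
    (φ : Set (D.carrier X) → Set (D.carrier Y)) : Prop :=
  ∀ s ∈ D.crossSections F t, s Y = φ (s X)

end Diagram

/-! ### Diagrams generated by a set of maps -/

/-- A set of maps between sets, as a predicate on maps. -/
abbrev MapSet : Type 1 :=
  ∀ ⦃X Y : Type⦄, (X → Y) → Prop

/-- The set of maps generated by `𝓜`. Products of several factors are iterated binary products, so
that their projections and product maps are obtained from the binary ones (and composition). -/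
inductive GeneratedMap (𝓜 : MapSet) : ∀ ⦃X Y : Type⦄, (X → Y) → Prop
  | base {X Y : Type} {f : X → Y} : 𝓜 f → GeneratedMap 𝓜 f
  | id (X : Type) : GeneratedMap 𝓜 (fun x : X => x)
  | omega (X : Type) : GeneratedMap 𝓜 (fun _ : X => (0 : Fin 1))
  | fst (X Y : Type) : GeneratedMap 𝓜 (Prod.fst : X × Y → X)
  | snd (X Y : Type) : GeneratedMap 𝓜 (Prod.snd : X × Y → Y)
  | comp {X Y Z : Type} {f : X → Y} {g : Y → Z} :
      GeneratedMap 𝓜 f → GeneratedMap 𝓜 g → GeneratedMap 𝓜 (fun x => g (f x))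
  | prod {X Y Z : Type} {f : X → Y} {g : X → Z} :
      GeneratedMap 𝓜 f → GeneratedMap 𝓜 g → GeneratedMap 𝓜 (fun x => (f x, g x))

/-- Every map of the diagram is the direct image map or the inverse image map of a map generated
by `𝓜`. -/
def Diagram.IsGeneratedBy (D : Diagram) (𝓜 : MapSet) : Prop :=
  ∀ (S T : D.Index) (φ : D.Arrow S T),
    (∃ f : D.carrier S → D.carrier T, GeneratedMap 𝓜 f ∧ ∀ A, D.map φ A = f '' A) ∨
    (∃ f : D.carrier T → D.carrier S, GeneratedMap 𝓜 f ∧ ∀ A, D.map φ A = f ⁻¹' A)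

/-- The set `{0, succ}` of maps, where `0` is the constant map from the one-point set `{0}`. -/
inductive NatMaps : ∀ ⦃X Y : Type⦄, (X → Y) → Prop
  | zero : NatMaps (fun _ : Fin 1 => (0 : ℕ))
  | succ : NatMaps Nat.succ

/-! ### Turing machines with binary alphabet -/

/-- A deterministic one-tape Turing machine with states `Q`, tape symbols `Θ` and input
alphabet `{0, 1}`. In the value of `δ`, the last component is the direction of the
move: `0` is left and `1` is right. -/
structure BinaryTM (Q Θ : Type*) where
  bit : Fin 2 → Θ
  bit_injective : Function.Injective bit
  blank : Θ
  blank_ne_bit : ∀ b, bit b ≠ blank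
  δ : Θ × Q → Θ × Q × Fin 2
  start : Q
  accept : Q
  reject : Q
  accept_ne_reject : accept ≠ reject

namespace BinaryTM

variable {Q Θ : Type*}

/-- A configuration; the tape is infinite to the right. -/
structure Config (Q Θ : Type*) where
  tape : ℕ → Θ
  state : Q
  head : ℕ

/-- The tape that holds the string `σ` at its left end and blanks elsewhere. -/
def tapeOf (M : BinaryTM Q Θ) (σ : List (Fin 2)) : ℕ → Θ :=
  fun i => if h : i < σ.length then M.bit σ[i] else M.blank

/-- The initial configuration with input `σ`. -/
def initial (M : BinaryTM Q Θ) (σ : List (Fin 2)) : Config Q Θ :=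
  ⟨M.tapeOf σ, M.start, 0⟩

open Classical in
/-- One step. The machine stops in the accept and reject states; a move to the left at the left end
of the tape leaves the head there. -/
noncomputable def step (M : BinaryTM Q Θ) (c : Config Q Θ) : Config Q Θ :=
  if c.state = M.accept ∨ c.state = M.reject then c
  else
    { tape := Function.update c.tape c.head (M.δ (c.tape c.head, c.state)).1
      state := (M.δ (c.tape c.head, c.state)).2.1
      head := if (M.δ (c.tape c.head, c.state)).2.2 = 0 then c.head - 1 else c.head + 1 }

/-- The configuration after `n` steps with input `σ`. -/
noncomputable def run (M : BinaryTM Q Θ) (σ : List (Fin 2)) (n : ℕ) : Config Q Θ :=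
  M.step^[n] (M.initial σ)

/-- The machine accepts `σ`, leaving the string `τ` (and otherwise blanks) on its tape. -/
def AcceptsLeaving (M : BinaryTM Q Θ) (σ τ : List (Fin 2)) : Prop :=
  ∃ n, (M.run σ n).state = M.accept ∧ (M.run σ n).tape = M.tapeOf τ

/-- The machine rejects `σ`. -/
def Rejects (M : BinaryTM Q Θ) (σ : List (Fin 2)) : Prop :=
  ∃ n, (M.run σ n).state = M.reject

/-- The machine does not terminate with input `σ`. -/
def Diverges (M : BinaryTM Q Θ) (σ : List (Fin 2)) : Prop :=
  ∀ n, (M.run σ n).state ≠ M.accept ∧ (M.run σ n).state ≠ M.reject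

end BinaryTM

/-- The subset of `ℕ × ℕ` that represents the binary string `σ`: the pairs `(i, σ[i])` together
with the terminating pairs `(|σ|, 0)` and `(|σ|, 1)`. -/
def stringSet (σ : List (Fin 2)) : Set (ℕ × ℕ) :=
  {p | ∃ (i : ℕ) (h : i < σ.length), p = (i, (σ[i] : ℕ))} ∪ {(σ.length, 0), (σ.length, 1)}

/-! A Turing machine is simulated by a cellular automaton on a half-line, and the space-time history
of an automaton solves a finite system of set equations, which is what a cross section of a diagram
does. Each cell content γ gets a member holding the pairs (t, p) of a time and a cell at which γ
occurs. A local rule intersects shifted inverse images of such sets and sends the result forward by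
a direct image such as (t, p) ↦ (t + 1, p + 1); the set of γ is the union over the rules that
produce γ.

Only monotone operations are available, so "beyond the end of the input" has to be expressed
positively. The code of a string permits this: its end is the only position carrying both bits, and
the other positions are located by the order on ℕ, which is itself the solution of a recursive
equation.

Every cyclic equation raises time or position by one, so induction shows that a cross section is
determined by its input set (`eq_solution`); it exists for every input set
(`isCrossSection_solution`). If the input is not a code, several contents may occur in one cell;
this is harmless, because the output is defined by derivability alone. On codes exactly one content
occurs (`occurs_stringSet_iff`), and the output is the string read at accepting times
(`output_stringSet`). One step of the automaton matches one step of the machine by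
`content_step_zero` and `content_step_succ`. -/

open Set

/-! ### Generated maps on natural numbers -/

namespace GeneratedMap

theorem const {X : Type} (n : ℕ) : GeneratedMap NatMaps (fun _ : X => n) := by
  induction n with
  | zero => exact comp (f := fun _ : X => (0 : Fin 1)) (g := fun _ => 0) (.omega X) (.base .zero)
  | succ n ih => exact comp (f := fun _ : X => n) (g := Nat.succ) ih (.base .succ)

theorem add_one {X : Type} {f : X → ℕ} (hf : GeneratedMap NatMaps f) :
    GeneratedMap NatMaps (fun x => f x + 1) :=
  comp (g := Nat.succ) hf (.base .succ)

end GeneratedMap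

/-! ### Cellular automata on a half-line -/

/-- A cellular automaton on the cells `0, 1, 2, …` that reads and writes binary strings: `raw` gives
the initial content of a cell (`none` stands for a cell beyond the end of the input), `edge` is the
transition rule of cell `0` and `bulk` that of the other cells, `acc` are the contents that signal
acceptance, and `reads` interprets contents as output. -/
structure CellAut (Γ : Type*) where
  raw : Option (Fin 2) → Γ
  edge : Γ → Γ → Γ
  bulk : Γ → Γ → Γ → Γ
  acc : Γ → Prop
  reads : Γ → Option (Fin 2) → Prop

namespace CellAut

/-- The positions at which both bits occur. -/
def ends (A : Set (ℕ × ℕ)) : Set ℕ := {p | (p, 0) ∈ A ∧ (p, 1) ∈ A}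

/-- The positions at which the string coded by `A` has the entry `x`. -/
def source (A : Set (ℕ × ℕ)) : Option (Fin 2) → Set ℕ
  | none => {p | ∃ e ∈ ends A, e ≤ p}
  | some b => {p | (∃ e ∈ ends A, p < e) ∧ (p, (b : ℕ)) ∈ A}

variable {Γ : Type*} (C : CellAut Γ)

/-- `C.Occurs A t p γ`: the content `γ` is derivable for cell `p` at time `t` from the initial
contents coded by `A`. -/
def Occurs (A : Set (ℕ × ℕ)) : ℕ → ℕ → Γ → Prop
  | 0, p, γ => ∃ x, C.raw x = γ ∧ p ∈ source A x
  | t + 1, 0, γ => ∃ α β, C.edge α β = γ ∧ Occurs A t 0 α ∧ Occurs A t 1 β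
  | t + 1, p + 1, γ => ∃ α β δ, C.bulk α β δ = γ ∧
      Occurs A t p α ∧ Occurs A t (p + 1) β ∧ Occurs A t (p + 2) δ

/-- The times at which acceptance is signalled. -/
def accTimes (A : Set (ℕ × ℕ)) : Set ℕ := {t | ∃ γ, C.acc γ ∧ ∃ p, C.Occurs A t p γ}

/-- The pairs of an accepting time and a cell that is then read as `x`. -/
def final (A : Set (ℕ × ℕ)) (x : Option (Fin 2)) : Set (ℕ × ℕ) :=
  {z | (∃ γ, C.reads γ x ∧ C.Occurs A z.1 z.2 γ) ∧ z.1 ∈ C.accTimes A}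

/-- The output of the automaton. -/
def output (A : Set (ℕ × ℕ)) : Set (ℕ × ℕ) :=
  {z | (∃ b : Fin 2, ∃ t p, (t, p) ∈ C.final A (some b) ∧ (p, (b : ℕ)) = z) ∨
    (∃ c : Fin 2, ∃ t, (t, 0) ∈ C.final A none ∧ (0, (c : ℕ)) = z) ∨
    (∃ b c : Fin 2, ∃ t p, ((t, p) ∈ C.final A (some b) ∧ (t, p + 1) ∈ C.final A none) ∧
      (p + 1, (c : ℕ)) = z)}

/-- This is the recursion by which the diagram generates an upward closed set: start at the ends and
close under successor. -/
theorem mem_source_none {A : Set (ℕ × ℕ)} {p : ℕ} :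
    p ∈ source A none ↔ p ∈ ends A ∨ ∃ q ∈ source A none, q + 1 = p := by
  constructor
  · rintro ⟨e, he, hep⟩
    rcases hep.eq_or_lt with rfl | h
    · exact .inl he
    · exact .inr ⟨p - 1, ⟨e, he, by omega⟩, by omega⟩
  · rintro (h | ⟨q, ⟨e, he, hq⟩, rfl⟩)
    · exact ⟨p, h, le_rfl⟩
    · exact ⟨e, he, by omega⟩

/-! ### The output on codes of strings -/

theorem mem_stringSet {σ : List (Fin 2)} {p c : ℕ} :
    (p, c) ∈ stringSet σ ↔
      (∃ b : Fin 2, σ[p]? = some b ∧ (b : ℕ) = c) ∨ p = σ.length ∧ c < 2 := by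
  unfold stringSet
  simp only [mem_union, mem_ofPred_eq, mem_insert_iff, mem_singleton_iff, Prod.mk.injEq,
    List.getElem?_eq_some_iff]
  constructor
  · rintro (⟨i, h, rfl, rfl⟩ | ⟨rfl, rfl⟩ | ⟨rfl, rfl⟩)
    · exact .inl ⟨_, ⟨h, rfl⟩, rfl⟩
    · simp
    · simp
  · rintro (⟨b, ⟨h, rfl⟩, rfl⟩ | ⟨rfl, h⟩)
    · exact .inl ⟨p, h, rfl, rfl⟩
    · right; omega

/-- Before its end a code has one bit at each position, beyond it none. -/
theorem mem_ends_stringSet {σ : List (Fin 2)} {p : ℕ} : p ∈ ends (stringSet σ) ↔ p = σ.length := by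
  simp only [ends, mem_ofPred_eq, mem_stringSet]
  constructor
  · rintro ⟨⟨b, h, hb⟩ | ⟨h, -⟩, ⟨b', h', hb'⟩ | ⟨h', -⟩⟩ <;> try assumption
    rw [h] at h'
    simp only [Option.some.injEq] at h'
    subst h'
    omega
  · rintro rfl
    simp

/-- The strict bound `p < e` in `source` discards the terminating pairs, which would otherwise be
read as entries. -/
theorem mem_source_stringSet {σ : List (Fin 2)} {p : ℕ} {x : Option (Fin 2)} :
    p ∈ source (stringSet σ) x ↔ σ[p]? = x := by
  cases x with
  | none => simp [source, mem_ends_stringSet]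
  | some b =>
    simp only [source, mem_ofPred_eq, mem_ends_stringSet, mem_stringSet, exists_eq_left]
    constructor
    · rintro ⟨h, ⟨b', h', hb⟩ | ⟨rfl, -⟩⟩
      · rw [h', Fin.ext hb]
      · exact absurd h (lt_irrefl _)
    · intro h
      exact ⟨(List.getElem?_eq_some_iff.1 h).1, .inl ⟨b, h, rfl⟩⟩

variable {C} in
-- Determinism: a code offers exactly one initial content per cell, and the rules are functions, so
-- derivability follows the single computation `u`.
theorem occurs_stringSet_iff {σ : List (Fin 2)} {u : ℕ → ℕ → Γ} (h0 : ∀ p, u 0 p = C.raw σ[p]?)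
    (hedge : ∀ t, u (t + 1) 0 = C.edge (u t 0) (u t 1))
    (hbulk : ∀ t p, u (t + 1) (p + 1) = C.bulk (u t p) (u t (p + 1)) (u t (p + 2)))
    {t p : ℕ} {γ : Γ} : C.Occurs (stringSet σ) t p γ ↔ u t p = γ := by
  induction t generalizing p γ with
  | zero => simp [Occurs, mem_source_stringSet, h0]
  | succ t ih => cases p <;> simp [Occurs, ih, hedge, hbulk]

variable {C} in
-- By `hread` all accepting times yield the same reading, so taking the union over them adds
-- nothing.
theorem output_stringSet {σ τ : List (Fin 2)} {u : ℕ → ℕ → Γ} (h0 : ∀ p, u 0 p = C.raw σ[p]?)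
    (hedge : ∀ t, u (t + 1) 0 = C.edge (u t 0) (u t 1))
    (hbulk : ∀ t p, u (t + 1) (p + 1) = C.bulk (u t p) (u t (p + 1)) (u t (p + 2)))
    (hacc : ∃ t p, C.acc (u t p))
    (hread : ∀ t q, C.acc (u t q) → ∀ p x, C.reads (u t p) x ↔ τ[p]? = x) :
    C.output (stringSet σ) = stringSet τ := by
  have hfin : ∀ t p x, (t, p) ∈ C.final (stringSet σ) x ↔ (∃ q, C.acc (u t q)) ∧ τ[p]? = x := by
    intro t p x
    simp only [final, accTimes, occurs_stringSet_iff h0 hedge hbulk, mem_ofPred_eq]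
    constructor
    · rintro ⟨⟨_, h, rfl⟩, _, hq, q, rfl⟩
      exact ⟨⟨q, hq⟩, (hread t q hq p x).1 h⟩
    · rintro ⟨⟨q, hq⟩, h⟩
      exact ⟨⟨_, (hread t q hq p x).2 h, rfl⟩, _, hq, q, rfl⟩
  obtain ⟨t₀, q₀, hq₀⟩ := hacc
  ext ⟨p, c⟩
  simp only [output, hfin, mem_ofPred_eq, mem_stringSet, Prod.mk.injEq]
  constructor
  · rintro (⟨b, t, p', ⟨-, h⟩, rfl, rfl⟩ | ⟨c', t, ⟨-, h⟩, rfl, rfl⟩ |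
      ⟨b, c', t, p', ⟨⟨-, h⟩, -, h'⟩, rfl, rfl⟩)
    · exact .inl ⟨b, h, rfl⟩
    · rw [List.getElem?_eq_none_iff] at h
      exact .inr ⟨by omega, c'.2⟩
    · rw [List.getElem?_eq_none_iff] at h'
      have := (List.getElem?_eq_some_iff.1 h).1
      exact .inr ⟨by omega, c'.2⟩
  · rintro (⟨b, h, rfl⟩ | ⟨rfl, hc⟩)
    · exact .inl ⟨b, t₀, p, ⟨⟨q₀, hq₀⟩, h⟩, rfl, rfl⟩
    -- Every cell beyond the end is also read as `none`. The first such cell is recognized as cell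
    -- 0, or as the successor of a cell that holds a bit.
    · rcases hn : τ.length with _ | n
      · exact .inr (.inl ⟨⟨c, hc⟩, t₀, ⟨⟨q₀, hq₀⟩, by simp [hn]⟩, rfl, rfl⟩)
      · exact .inr (.inr ⟨τ[n], ⟨c, hc⟩, t₀, n,
          ⟨⟨⟨q₀, hq₀⟩, by simp⟩, ⟨q₀, hq₀⟩, by simp [hn]⟩, rfl, rfl⟩)

variable {C} in
theorem output_stringSet_eq_empty {σ : List (Fin 2)} {u : ℕ → ℕ → Γ}
    (h0 : ∀ p, u 0 p = C.raw σ[p]?)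
    (hedge : ∀ t, u (t + 1) 0 = C.edge (u t 0) (u t 1))
    (hbulk : ∀ t p, u (t + 1) (p + 1) = C.bulk (u t p) (u t (p + 1)) (u t (p + 2)))
    (hacc : ∀ t p, ¬ C.acc (u t p)) : C.output (stringSet σ) = ∅ := by
  have hfin : ∀ x, C.final (stringSet σ) x = ∅ := by
    intro x
    simp only [final, accTimes, occurs_stringSet_iff h0 hedge hbulk, eq_empty_iff_forall_notMem]
    rintro ⟨t, p⟩ ⟨-, _, hq, q, rfl⟩
    exact hacc t q hq
  simp [output, hfin]

/-! ### The diagram of a cellular automaton -/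

/-- The members of the diagram of a cellular automaton with alphabet `Γ`. -/
inductive Idx (Γ : Type) : Type
  | one
  | input
  | output
  | void
  | nat
  | less
  | ends
  | before
  | inside
  | source (x : Option (Fin 2))
  | cell (γ : Γ)
  | edgeWindow (α β : Γ)
  | bulkWindow (α β γ : Γ)
  | accTimes
  | reading (x : Option (Fin 2))
  | final (x : Option (Fin 2))
  | endAtZero
  | endAfter (b : Fin 2)

namespace Idx

/-- The sets that form the diagram. -/
@[reducible] def carrier {Γ : Type} : Idx Γ → Type
  | one => Fin 1
  | nat | ends | inside | source _ | edgeWindow _ _ | accTimes | endAtZero => ℕ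
  | input | output | void | less | before | cell _ | bulkWindow _ _ _ | reading _ | final _
  | endAfter _ => ℕ × ℕ

/-- The members on which a cross section is the union of the incoming sets. -/
def IsUnion {Γ : Type} : Idx Γ → Prop
  | output | void | less | source none | cell _ | accTimes | reading _ => True
  | _ => False

end Idx

variable {Γ : Type} (C : CellAut Γ)

/-- The maps of the diagram of a cellular automaton. -/
inductive Arr : Idx Γ → Idx Γ → Type
  | nat : Arr .one .nat
  | lessZero : Arr .nat .less
  | lessSucc : Arr .less .less
  | ends (b : Fin 2) : Arr .input .ends
  | beforeLess : Arr .less .before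
  | beforeEnds : Arr .ends .before
  | inside : Arr .before .inside
  | blankEnds : Arr .ends (.source none)
  | blankSucc : Arr (.source none) (.source none)
  | bitInside (b : Fin 2) : Arr .inside (.source (some b))
  | bitInput (b : Fin 2) : Arr .input (.source (some b))
  | void : Arr .void .void
  | cellVoid (γ : Γ) : Arr .void (.cell γ)
  | accVoid : Arr .void .accTimes
  | readingVoid (x : Option (Fin 2)) : Arr .void (.reading x)
  | raw (x : Option (Fin 2)) : Arr (.source x) (.cell (C.raw x))
  | edge (α β : Γ) : Arr (.edgeWindow α β) (.cell (C.edge α β))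
  | bulk (α β γ : Γ) : Arr (.bulkWindow α β γ) (.cell (C.bulk α β γ))
  | edgeFst (α β : Γ) : Arr (.cell α) (.edgeWindow α β)
  | edgeSnd (α β : Γ) : Arr (.cell β) (.edgeWindow α β)
  | bulkFst (α β γ : Γ) : Arr (.cell α) (.bulkWindow α β γ)
  | bulkSnd (α β γ : Γ) : Arr (.cell β) (.bulkWindow α β γ)
  | bulkTrd (α β γ : Γ) : Arr (.cell γ) (.bulkWindow α β γ)
  | accTimes (γ : Γ) (h : C.acc γ) : Arr (.cell γ) .accTimes
  | reading (γ : Γ) (x : Option (Fin 2)) (h : C.reads γ x) : Arr (.cell γ) (.reading x)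
  | finalReading (x : Option (Fin 2)) : Arr (.reading x) (.final x)
  | finalAcc (x : Option (Fin 2)) : Arr .accTimes (.final x)
  | endAtZero : Arr (.final none) .endAtZero
  | endAfterBit (b : Fin 2) : Arr (.final (some b)) (.endAfter b)
  | endAfterBlank (b : Fin 2) : Arr (.final none) (.endAfter b)
  | outBit (b : Fin 2) : Arr (.final (some b)) .output
  | outZero (c : Fin 2) : Arr .endAtZero .output
  | outAfter (b c : Fin 2) : Arr (.endAfter b) .output

namespace Arr

variable {C}

/-- The map between power sets that belongs to an arrow. -/
def map : ∀ {S T : Idx Γ}, Arr C S T → Set S.carrier → Set T.carrier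
  | _, _, nat => fun A => (fun _ : ℕ => (0 : Fin 1)) ⁻¹' A
  | _, _, lessZero => fun A => (fun j : ℕ => (0, j + 1)) '' A
  | _, _, lessSucc => fun A => (fun z : ℕ × ℕ => (z.1 + 1, z.2 + 1)) '' A
  | _, _, ends b => fun A => (fun p : ℕ => (p, (b : ℕ))) ⁻¹' A
  | _, _, beforeLess => fun A => (fun z : ℕ × ℕ => z) ⁻¹' A
  | _, _, beforeEnds => fun A => (Prod.snd : ℕ × ℕ → ℕ) ⁻¹' A
  | _, _, inside => fun A => (Prod.fst : ℕ × ℕ → ℕ) '' A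
  | _, _, blankEnds => fun A => (fun p : ℕ => p) ⁻¹' A
  | _, _, blankSucc => fun A => (fun p : ℕ => p + 1) '' A
  | _, _, bitInside _ => fun A => (fun p : ℕ => p) ⁻¹' A
  | _, _, bitInput b => fun A => (fun p : ℕ => (p, (b : ℕ))) ⁻¹' A
  | _, _, void => fun A => (fun z : ℕ × ℕ => (z.1 + 1, z.2)) '' A
  | _, _, cellVoid _ => fun A => (fun z : ℕ × ℕ => z) ⁻¹' A
  | _, _, accVoid => fun A => (Prod.fst : ℕ × ℕ → ℕ) '' A
  | _, _, readingVoid _ => fun A => (fun z : ℕ × ℕ => z) ⁻¹' A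
  | _, _, raw _ => fun A => (fun p : ℕ => (0, p)) '' A
  | _, _, edge _ _ => fun A => (fun t : ℕ => (t + 1, 0)) '' A
  | _, _, bulk _ _ _ => fun A => (fun z : ℕ × ℕ => (z.1 + 1, z.2 + 1)) '' A
  | _, _, edgeFst _ _ => fun A => (fun t : ℕ => (t, 0)) ⁻¹' A
  | _, _, edgeSnd _ _ => fun A => (fun t : ℕ => (t, 1)) ⁻¹' A
  | _, _, bulkFst _ _ _ => fun A => (fun z : ℕ × ℕ => z) ⁻¹' A
  | _, _, bulkSnd _ _ _ => fun A => (fun z : ℕ × ℕ => (z.1, z.2 + 1)) ⁻¹' A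
  | _, _, bulkTrd _ _ _ => fun A => (fun z : ℕ × ℕ => (z.1, z.2 + 1 + 1)) ⁻¹' A
  | _, _, accTimes _ _ => fun A => (Prod.fst : ℕ × ℕ → ℕ) '' A
  | _, _, reading _ _ _ => fun A => (fun z : ℕ × ℕ => z) ⁻¹' A
  | _, _, finalReading _ => fun A => (fun z : ℕ × ℕ => z) ⁻¹' A
  | _, _, finalAcc _ => fun A => (Prod.fst : ℕ × ℕ → ℕ) ⁻¹' A
  | _, _, endAtZero => fun A => (fun t : ℕ => (t, 0)) ⁻¹' A
  | _, _, endAfterBit _ => fun A => (fun z : ℕ × ℕ => z) ⁻¹' A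
  | _, _, endAfterBlank _ => fun A => (fun z : ℕ × ℕ => (z.1, z.2 + 1)) ⁻¹' A
  | _, _, outBit b => fun A => (fun z : ℕ × ℕ => (z.2, (b : ℕ))) '' A
  | _, _, outZero c => fun A => (fun _ : ℕ => (0, (c : ℕ))) '' A
  | _, _, outAfter _ c => fun A => (fun z : ℕ × ℕ => (z.2 + 1, (c : ℕ))) '' A

end Arr

/-- The diagram of a cellular automaton. -/
def diagram : Diagram where
  Index := Idx Γ
  carrier := Idx.carrier
  unionPart := {T | T.IsUnion}
  Arrow := Arr C
  map := Arr.map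

theorem finite_idx [Finite Γ] : Finite (Idx Γ) := by
  refine finite_univ_iff.1 (((((((((toFinite {.one, .input, .output, .void, .nat, .less, .ends,
    .before, .inside, .accTimes, .endAtZero}).union (finite_range Idx.source)).union
    (finite_range Idx.cell)).union
    (finite_range fun a : Γ × Γ => Idx.edgeWindow a.1 a.2)).union
    (finite_range fun a : Γ × Γ × Γ => Idx.bulkWindow a.1 a.2.1 a.2.2)).union
    (finite_range Idx.reading)).union (finite_range Idx.final)).union
    (finite_range Idx.endAfter)).subset ?_)
  rintro (_ | _) - <;> simp

theorem finite_arr (S T : Idx Γ) : Finite (Arr C S T) := by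
  -- The tag only has to separate arrows with the same source and target, for instance the two
  -- projections of a window with equal contents.
  refine Finite.of_injective (β := Fin 2 × Fin 2) (fun φ => match φ with
    | .ends b => (b, 0)
    | .lessSucc => (0, 1)
    | .edgeSnd _ _ => (0, 1)
    | .bulkSnd _ _ _ => (0, 1)
    | .bulkTrd _ _ _ => (1, 1)
    | .outAfter _ c => (c, 0)
    | .outZero c => (c, 0)
    | _ => (0, 0)) ?_
  intro φ ψ h
  cases φ <;> cases ψ <;> simp_all

theorem isFinite_diagram [Finite Γ] : C.diagram.IsFinite := by
  have := finite_idx (Γ := Γ)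
  have := C.finite_arr
  exact ⟨inferInstanceAs (Finite (Idx Γ)), inferInstanceAs (Finite (Σ S T : Idx Γ, Arr C S T))⟩

theorem isGeneratedBy_diagram : C.diagram.IsGeneratedBy NatMaps := by
  intro S T φ
  have hfst : GeneratedMap NatMaps fun z : ℕ × ℕ => z.1 := .fst ℕ ℕ
  have hsnd : GeneratedMap NatMaps fun z : ℕ × ℕ => z.2 := .snd ℕ ℕ
  have hid : GeneratedMap NatMaps fun p : ℕ => p := .id ℕ
  cases φ with
  | nat => exact .inr ⟨_, .omega ℕ, fun _ => rfl⟩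
  | lessZero => exact .inl ⟨_, .prod (.const 0) hid.add_one, fun _ => rfl⟩
  | lessSucc => exact .inl ⟨_, .prod hfst.add_one hsnd.add_one, fun _ => rfl⟩
  | ends b => exact .inr ⟨_, .prod hid (.const b), fun _ => rfl⟩
  | beforeLess => exact .inr ⟨_, .id _, fun _ => rfl⟩
  | beforeEnds => exact .inr ⟨_, hsnd, fun _ => rfl⟩
  | inside => exact .inl ⟨_, hfst, fun _ => rfl⟩
  | blankEnds => exact .inr ⟨_, hid, fun _ => rfl⟩
  | blankSucc => exact .inl ⟨_, hid.add_one, fun _ => rfl⟩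
  | bitInside b => exact .inr ⟨_, hid, fun _ => rfl⟩
  | bitInput b => exact .inr ⟨_, .prod hid (.const b), fun _ => rfl⟩
  | void => exact .inl ⟨_, .prod hfst.add_one hsnd, fun _ => rfl⟩
  | cellVoid γ => exact .inr ⟨_, .id _, fun _ => rfl⟩
  | accVoid => exact .inl ⟨_, hfst, fun _ => rfl⟩
  | readingVoid x => exact .inr ⟨_, .id _, fun _ => rfl⟩
  | raw x => exact .inl ⟨_, .prod (.const 0) hid, fun _ => rfl⟩
  | edge α β => exact .inl ⟨_, .prod hid.add_one (.const 0), fun _ => rfl⟩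
  | bulk α β γ => exact .inl ⟨_, .prod hfst.add_one hsnd.add_one, fun _ => rfl⟩
  | edgeFst α β => exact .inr ⟨_, .prod hid (.const 0), fun _ => rfl⟩
  | edgeSnd α β => exact .inr ⟨_, .prod hid (.const 1), fun _ => rfl⟩
  | bulkFst α β γ => exact .inr ⟨_, .id _, fun _ => rfl⟩
  | bulkSnd α β γ => exact .inr ⟨_, .prod hfst hsnd.add_one, fun _ => rfl⟩
  | bulkTrd α β γ => exact .inr ⟨_, .prod hfst hsnd.add_one.add_one, fun _ => rfl⟩
  | accTimes γ h => exact .inl ⟨_, hfst, fun _ => rfl⟩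
  | reading γ x h => exact .inr ⟨_, .id _, fun _ => rfl⟩
  | finalReading x => exact .inr ⟨_, .id _, fun _ => rfl⟩
  | finalAcc x => exact .inr ⟨_, hfst, fun _ => rfl⟩
  | endAtZero => exact .inr ⟨_, .prod hid (.const 0), fun _ => rfl⟩
  | endAfterBit b => exact .inr ⟨_, .id _, fun _ => rfl⟩
  | endAfterBlank b => exact .inr ⟨_, .prod hfst hsnd.add_one, fun _ => rfl⟩
  | outBit b => exact .inl ⟨_, .prod hsnd (.const b), fun _ => rfl⟩
  | outZero c => exact .inl ⟨_, .prod (.const 0) (.const c), fun _ => rfl⟩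
  | outAfter b c => exact .inl ⟨_, .prod hsnd.add_one (.const c), fun _ => rfl⟩

/-- The right-hand sides of the equations that define the cross sections of the diagram. -/
def Rhs (s : ∀ S : Idx Γ, Set S.carrier) : ∀ T : Idx Γ, T.carrier → Prop
  | .one, x => x ∈ s .one
  | .input, z => z ∈ s .input
  | .output, z =>
    (∃ b : Fin 2, ∃ y ∈ s (.final (some b)), (y.2, (b : ℕ)) = z) ∨
    (∃ c : Fin 2, ∃ t ∈ s .endAtZero, (0, (c : ℕ)) = z) ∨
    ∃ b c : Fin 2, ∃ y ∈ s (.endAfter b), (y.2 + 1, (c : ℕ)) = z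
  | .void, z => ∃ y ∈ s .void, (y.1 + 1, y.2) = z
  | .nat, _ => (0 : Fin 1) ∈ s .one
  | .less, z => (∃ j ∈ s .nat, (0, j + 1) = z) ∨ ∃ y ∈ s .less, (y.1 + 1, y.2 + 1) = z
  | .ends, p => (p, 0) ∈ s .input ∧ (p, 1) ∈ s .input
  | .before, z => z ∈ s .less ∧ z.2 ∈ s .ends
  | .inside, p => ∃ z ∈ s .before, z.1 = p
  | .source none, p => p ∈ s .ends ∨ ∃ q ∈ s (.source none), q + 1 = p
  | .source (some b), p => p ∈ s .inside ∧ (p, (b : ℕ)) ∈ s .input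
  | .cell γ, z => z ∈ s .void ∨
    (∃ x, C.raw x = γ ∧ ∃ p ∈ s (.source x), (0, p) = z) ∨
    (∃ α β, C.edge α β = γ ∧ ∃ t ∈ s (.edgeWindow α β), (t + 1, 0) = z) ∨
    ∃ α β δ, C.bulk α β δ = γ ∧ ∃ y ∈ s (.bulkWindow α β δ), (y.1 + 1, y.2 + 1) = z
  | .edgeWindow α β, t => (t, 0) ∈ s (.cell α) ∧ (t, 1) ∈ s (.cell β)
  | .bulkWindow α β γ, z =>
    z ∈ s (.cell α) ∧ (z.1, z.2 + 1) ∈ s (.cell β) ∧ (z.1, z.2 + 2) ∈ s (.cell γ)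
  | .accTimes, t => (∃ z ∈ s .void, z.1 = t) ∨ ∃ γ, C.acc γ ∧ ∃ z ∈ s (.cell γ), z.1 = t
  | .reading x, z => z ∈ s .void ∨ ∃ γ, C.reads γ x ∧ z ∈ s (.cell γ)
  | .final x, z => z ∈ s (.reading x) ∧ z.1 ∈ s .accTimes
  | .endAtZero, t => (t, 0) ∈ s (.final none)
  | .endAfter b, z => z ∈ s (.final (some b)) ∧ (z.1, z.2 + 1) ∈ s (.final none)

/-! ### Cross sections as solutions of a system of equations -/

variable {C} {s : ∀ S : Idx Γ, Set S.carrier}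

theorem exists_arr_iff {T : Idx Γ} (hT : T.IsUnion) (x : T.carrier) :
    (∃ (S : Idx Γ) (φ : Arr C S T), x ∈ φ.map (s S)) ↔ C.Rhs s T x := by
  constructor
  · rintro ⟨S, φ, h⟩
    cases φ with
    | lessZero => exact .inl h
    | lessSucc => exact .inr h
    | blankEnds => exact .inl h
    | blankSucc => exact .inr h
    | void => exact h
    | cellVoid γ => exact .inl h
    | accVoid => exact .inl h
    | readingVoid x => exact .inl h
    | raw y => exact .inr (.inl ⟨y, rfl, h⟩)
    | edge α β => exact .inr (.inr (.inl ⟨α, β, rfl, h⟩))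
    | bulk α β γ => exact .inr (.inr (.inr ⟨α, β, γ, rfl, h⟩))
    | accTimes γ hγ => exact .inr ⟨γ, hγ, h⟩
    | reading γ y hγ => exact .inr ⟨γ, hγ, h⟩
    | outBit b => exact .inl ⟨b, h⟩
    | outZero c => exact .inr (.inl ⟨c, h⟩)
    | outAfter b c => exact .inr (.inr ⟨b, c, h⟩)
    | _ => exact hT.elim
  · intro h
    match T, hT, x, h with
    | .less, _, _, .inl h => exact ⟨_, .lessZero, h⟩
    | .less, _, _, .inr h => exact ⟨_, .lessSucc, h⟩
    | .source none, _, _, .inl h => exact ⟨_, .blankEnds, h⟩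
    | .source none, _, _, .inr h => exact ⟨_, .blankSucc, h⟩
    | .void, _, _, h => exact ⟨_, .void, h⟩
    | .cell γ, _, _, .inl h => exact ⟨_, .cellVoid γ, h⟩
    | .cell _, _, _, .inr (.inl ⟨y, rfl, h⟩) => exact ⟨_, .raw y, h⟩
    | .cell _, _, _, .inr (.inr (.inl ⟨α, β, rfl, h⟩)) => exact ⟨_, .edge α β, h⟩
    | .cell _, _, _, .inr (.inr (.inr ⟨α, β, γ, rfl, h⟩)) => exact ⟨_, .bulk α β γ, h⟩
    | .accTimes, _, _, .inl h => exact ⟨_, .accVoid, h⟩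
    | .accTimes, _, _, .inr ⟨γ, hγ, h⟩ => exact ⟨_, .accTimes γ hγ, h⟩
    | .reading y, _, _, .inl h => exact ⟨_, .readingVoid y, h⟩
    | .reading y, _, _, .inr ⟨γ, hγ, h⟩ => exact ⟨_, .reading γ y hγ, h⟩
    | .output, _, _, .inl ⟨b, h⟩ => exact ⟨_, .outBit b, h⟩
    | .output, _, _, .inr (.inl ⟨c, h⟩) => exact ⟨_, .outZero c, h⟩
    | .output, _, _, .inr (.inr ⟨b, c, h⟩) => exact ⟨_, .outAfter b c, h⟩

theorem forall_arr_iff {T : Idx Γ} (hT : ¬ T.IsUnion) (h : ∃ S, Nonempty (Arr C S T))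
    (x : T.carrier) : (∀ (S : Idx Γ) (φ : Arr C S T), x ∈ φ.map (s S)) ↔ C.Rhs s T x := by
  constructor
  · intro h'
    match T, hT, x, h, h' with
    | .one, _, _, ⟨_, ⟨φ⟩⟩, _ => cases φ
    | .input, _, _, ⟨_, ⟨φ⟩⟩, _ => cases φ
    | .nat, _, _, _, h' => exact h' _ .nat
    | .ends, _, _, _, h' => exact ⟨h' _ (.ends 0), h' _ (.ends 1)⟩
    | .before, _, _, _, h' => exact ⟨h' _ .beforeLess, h' _ .beforeEnds⟩
    | .inside, _, _, _, h' => exact h' _ .inside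
    | .source (some b), _, _, _, h' => exact ⟨h' _ (.bitInside b), h' _ (.bitInput b)⟩
    | .edgeWindow α β, _, _, _, h' => exact ⟨h' _ (.edgeFst α β), h' _ (.edgeSnd α β)⟩
    | .bulkWindow α β γ, _, _, _, h' =>
      exact ⟨h' _ (.bulkFst α β γ), h' _ (.bulkSnd α β γ), h' _ (.bulkTrd α β γ)⟩
    | .final y, _, _, _, h' => exact ⟨h' _ (.finalReading y), h' _ (.finalAcc y)⟩
    | .endAtZero, _, _, _, h' => exact h' _ .endAtZero
    | .endAfter b, _, _, _, h' => exact ⟨h' _ (.endAfterBit b), h' _ (.endAfterBlank b)⟩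
    | .output, hT, _, _, _ => exact (hT trivial).elim
    | .void, hT, _, _, _ => exact (hT trivial).elim
    | .less, hT, _, _, _ => exact (hT trivial).elim
    | .source none, hT, _, _, _ => exact (hT trivial).elim
    | .cell _, hT, _, _, _ => exact (hT trivial).elim
    | .accTimes, hT, _, _, _ => exact (hT trivial).elim
    | .reading _, hT, _, _, _ => exact (hT trivial).elim
  · intro h' S φ
    cases φ with
    | nat => exact h'
    | ends b =>
      fin_cases b
      exacts [h'.1, h'.2]
    | beforeLess => exact h'.1
    | beforeEnds => exact h'.2
    | inside => exact h'
    | bitInside b => exact h'.1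
    | bitInput b => exact h'.2
    | edgeFst α β => exact h'.1
    | edgeSnd α β => exact h'.2
    | bulkFst α β γ => exact h'.1
    | bulkSnd α β γ => exact h'.2.1
    | bulkTrd α β γ => exact h'.2.2
    | finalReading y => exact h'.1
    | finalAcc y => exact h'.2
    | endAtZero => exact h'
    | endAfterBit b => exact h'.1
    | endAfterBlank b => exact h'.2
    | _ => exact (hT trivial).elim

/-- A member without incoming arrows would be unconstrained. The arrows from `void`, which is forced
to be empty, prevent this for contents that no rule produces, and for `accTimes` and `reading` when
no content qualifies. -/
theorem exists_arr {T : Idx Γ} (h1 : T ≠ .one) (h2 : T ≠ .input) : ∃ S, Nonempty (Arr C S T) := by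
  match T with
  | .output => exact ⟨_, ⟨.outBit 0⟩⟩
  | .void => exact ⟨_, ⟨.void⟩⟩
  | .nat => exact ⟨_, ⟨.nat⟩⟩
  | .less => exact ⟨_, ⟨.lessZero⟩⟩
  | .ends => exact ⟨_, ⟨.ends 0⟩⟩
  | .before => exact ⟨_, ⟨.beforeLess⟩⟩
  | .inside => exact ⟨_, ⟨.inside⟩⟩
  | .source none => exact ⟨_, ⟨.blankEnds⟩⟩
  | .source (some b) => exact ⟨_, ⟨.bitInput b⟩⟩
  | .cell γ => exact ⟨_, ⟨.cellVoid γ⟩⟩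
  | .edgeWindow α β => exact ⟨_, ⟨.edgeFst α β⟩⟩
  | .bulkWindow α β γ => exact ⟨_, ⟨.bulkFst α β γ⟩⟩
  | .accTimes => exact ⟨_, ⟨.accVoid⟩⟩
  | .reading x => exact ⟨_, ⟨.readingVoid x⟩⟩
  | .final x => exact ⟨_, ⟨.finalAcc x⟩⟩
  | .endAtZero => exact ⟨_, ⟨.endAtZero⟩⟩
  | .endAfter b => exact ⟨_, ⟨.endAfterBit b⟩⟩

/-- The cross sections are the solutions of a system of equations. -/
theorem isCrossSection_iff :
    C.diagram.IsCrossSection s ↔ ∀ (T : Idx Γ) (x : T.carrier), x ∈ s T ↔ C.Rhs s T x := by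
  constructor
  · intro h T x
    by_cases h1 : T = .one
    · subst h1; rfl
    by_cases h2 : T = .input
    · subst h2; rfl
    have h3 : ∃ S, Nonempty (Arr C S T) := exists_arr h1 h2
    by_cases hT : T.IsUnion
    · rw [← exists_arr_iff hT]
      exact (Set.ext_iff.1 ((h T h3).2 hT) x).trans (by simp [diagram])
    · rw [← forall_arr_iff hT h3]
      exact (Set.ext_iff.1 ((h T h3).1 hT) x).trans (by simp [diagram])
  · intro h T h3
    refine ⟨fun hT => Set.ext fun x => (h T x).trans ?_,
      fun hT => Set.ext fun x => (h T x).trans ?_⟩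
    · rw [← forall_arr_iff hT h3]
      simp [diagram]
    · rw [← exists_arr_iff hT]
      simp [diagram]

variable (C) in
/-- The cross section of the diagram with a given input. -/
def solution (A : Set (ℕ × ℕ)) : ∀ S : Idx Γ, Set S.carrier
  | .one => univ
  | .input => A
  | .output => C.output A
  | .void => ∅
  | .nat => univ
  | .less => {z | z.1 < z.2}
  | .ends => CellAut.ends A
  | .before => {z | z.1 < z.2 ∧ z.2 ∈ CellAut.ends A}
  | .inside => {p | ∃ e ∈ CellAut.ends A, p < e}
  | .source x => CellAut.source A x
  | .cell γ => {z | C.Occurs A z.1 z.2 γ}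
  | .edgeWindow α β => {t | C.Occurs A t 0 α ∧ C.Occurs A t 1 β}
  | .bulkWindow α β γ =>
    {z | C.Occurs A z.1 z.2 α ∧ C.Occurs A z.1 (z.2 + 1) β ∧ C.Occurs A z.1 (z.2 + 2) γ}
  | .accTimes => C.accTimes A
  | .reading x => {z | ∃ γ, C.reads γ x ∧ C.Occurs A z.1 z.2 γ}
  | .final x => C.final A x
  | .endAtZero => {t | (t, 0) ∈ C.final A none}
  | .endAfter b => {z | z ∈ C.final A (some b) ∧ (z.1, z.2 + 1) ∈ C.final A none}

theorem isCrossSection_solution (A : Set (ℕ × ℕ)) :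
    C.diagram.IsCrossSection (C.solution A) := by
  refine isCrossSection_iff.2 fun T x => ?_
  match T, x with
  | .one, x => rfl
  | .input, x => rfl
  | .output, z => simp [Rhs, solution, CellAut.output]
  | .void, z => simp [Rhs, solution]
  | .nat, n => simp [Rhs, solution]
  | .less, (i, j) =>
    cases i <;> cases j <;> simp [Rhs, solution]
  | .ends, p => rfl
  | .before, z => rfl
  | .inside, p =>
    simp only [Rhs, solution, mem_ofPred_eq, Prod.exists]
    exact ⟨fun ⟨e, he, h⟩ => ⟨p, e, ⟨h, he⟩, rfl⟩, fun ⟨_, e, ⟨h, he⟩, hp⟩ => ⟨e, he, hp ▸ h⟩⟩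
  | .source none, p =>
    refine mem_source_none.trans (or_congr Iff.rfl ?_)
    simp only [solution]
  | .source (some b), p => rfl
  | .cell γ, (t, p) =>
    cases t <;> cases p <;> simp [Rhs, solution, Occurs]
  | .edgeWindow α β, t => rfl
  | .bulkWindow α β γ, z => rfl
  | .accTimes, t => simp [Rhs, solution, CellAut.accTimes]
  | .reading y, z => simp [Rhs, solution]
  | .final y, z => rfl
  | .endAtZero, t => rfl
  | .endAfter b, z => rfl

/-- The prescribed full set on `one` makes `nat` full and so starts the recursion for `less`. The
cyclic members are settled by induction on time or position, the others by substitution. -/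
theorem eq_solution (hs : C.diagram.IsCrossSection s) (h1 : s .one = univ) :
    s = C.solution (s .input) := by
  rw [isCrossSection_iff] at hs
  obtain ⟨A, hA⟩ : ∃ A, s .input = A := ⟨_, rfl⟩
  -- A set of pairs that equals its own shift in time has no element of least time.
  have hvoid : s .void = ∅ := by
    refine eq_empty_iff_forall_notMem.2 ?_
    rintro ⟨n, m⟩
    induction n with
    | zero => rw [hs .void]; simp [Rhs]
    | succ n ih => rw [hs .void]; simpa [Rhs] using ih
  have hnat : s .nat = univ := by
    ext n; simp [hs .nat, Rhs, h1]
  have hless : s .less = {z | z.1 < z.2} := by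
    ext ⟨i, j⟩
    induction i generalizing j with
    | zero => rw [hs .less]; cases j <;> simp [Rhs, hnat]
    | succ i ih => rw [hs .less]; cases j <;> simp [Rhs, ih]
  have hends : s .ends = CellAut.ends A := by
    ext p; simp [hs .ends, Rhs, CellAut.ends, hA]
  have hinside : s .inside = {p | ∃ e ∈ CellAut.ends A, p < e} := by
    ext p; simp [hs .inside, hs .before, Rhs, hless, hends, and_comm]
  have hsource : ∀ x, s (.source x) = CellAut.source A x := by
    rintro (_ | b) <;> ext p
    · induction p with
      | zero => rw [hs, mem_source_none]; simp [Rhs, hends]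
      | succ p ih => rw [hs, mem_source_none]; simp [Rhs, hends, ih]
    · simp [hs (.source (some b)), Rhs, CellAut.source, hinside, hA]
  have hcell : ∀ γ, s (.cell γ) = {z | C.Occurs A z.1 z.2 γ} := by
    intro γ
    ext ⟨t, p⟩
    induction t generalizing p γ with
    | zero => rw [hs]; simp [Rhs, Occurs, hvoid, hsource]
    | succ t ih =>
      rw [hs]
      -- Unfolding the windows expresses time `t + 1` through time `t` alone; the induction runs
      -- over all contents and cells at once.
      cases p <;> simp [Rhs, Occurs, hvoid, hs (.edgeWindow _ _), hs (.bulkWindow _ _ _), ih]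
  have hacc : s .accTimes = C.accTimes A := by
    ext t; simp [hs .accTimes, Rhs, CellAut.accTimes, hcell, hvoid]
  have hreading : ∀ x, s (.reading x) = C.solution A (.reading x) := by
    intro x; ext z; simp [hs (.reading x), Rhs, solution, hcell, hvoid]
  have hfinal : ∀ x, s (.final x) = C.final A x := by
    intro x; ext z; simp [hs (.final x), Rhs, hreading, hacc, solution, CellAut.final]
  rw [hA]
  funext T
  ext x
  match T, x with
  | .one, x => simp [h1, solution]
  | .input, x => simp [hA, solution]
  | .output, z =>
    -- Both sides become the same expression in members already identified.
    rw [isCrossSection_iff.1 (isCrossSection_solution A), hs]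
    simp [Rhs, hs .endAtZero, hs (.endAfter _), hfinal, solution]
  | .void, z => rw [hvoid]; rfl
  | .nat, n => rw [hnat]; rfl
  | .less, z => rw [hless]; rfl
  | .ends, p => rw [hends]; rfl
  | .before, z => rw [hs]; simp [Rhs, hless, hends, solution]
  | .inside, p => rw [hinside]; rfl
  | .source x, p => rw [hsource]; rfl
  | .cell γ, z => rw [hcell]; rfl
  | .edgeWindow α β, t => rw [hs]; simp [Rhs, hcell, solution]
  | .bulkWindow α β γ, z => rw [hs]; simp [Rhs, hcell, solution]
  | .accTimes, t => rw [hacc]; rfl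
  | .reading y, z => rw [hreading]
  | .final y, z => rw [hfinal]; rfl
  | .endAtZero, t => rw [hs]; simp [Rhs, hfinal, solution]
  | .endAfter b, z => rw [hs]; simp [Rhs, hfinal, solution]

/-- The index type of a diagram lies in `Type`, whereas the alphabet may live in any universe; the
automaton is therefore transported to `Fin n`. -/
theorem exists_diagram {Γ : Type*} [Finite Γ] (C : CellAut Γ) :
    ∃ (D : Diagram) (one S T : D.Index) (_ : Fin 1 = D.carrier one)
      (hS : (ℕ × ℕ) = D.carrier S) (hT : (ℕ × ℕ) = D.carrier T)
      (Mbar : Set (D.carrier S) → Set (D.carrier T)),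
      D.IsFinite ∧ D.IsGeneratedBy NatMaps ∧ S ≠ T ∧
      (∀ (σ : List (Fin 2)) (u : ℕ → ℕ → Γ), (∀ p, u 0 p = C.raw σ[p]?) →
        (∀ t, u (t + 1) 0 = C.edge (u t 0) (u t 1)) →
        (∀ t p, u (t + 1) (p + 1) = C.bulk (u t p) (u t (p + 1)) (u t (p + 2))) →
        (∀ τ : List (Fin 2), (∃ t p, C.acc (u t p)) →
          (∀ t q, C.acc (u t q) → ∀ p x, C.reads (u t p) x ↔ τ[p]? = x) →
          Mbar (cast (congrArg Set hS) (stringSet σ)) = cast (congrArg Set hT) (stringSet τ)) ∧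
        ((∀ t p, ¬ C.acc (u t p)) → Mbar (cast (congrArg Set hS) (stringSet σ)) = ∅)) ∧
      D.RepresentsMap {one} (fun _ => Set.univ) S T Mbar ∧
      (∀ A : Set (D.carrier S), ∃ s ∈ D.crossSections {one} (fun _ => Set.univ), s S = A) := by
  obtain ⟨n, ⟨e⟩⟩ := Finite.exists_equiv_fin Γ
  let C' : CellAut (Fin n) :=
    { raw := fun x => e (C.raw x)
      edge := fun α β => e (C.edge (e.symm α) (e.symm β))
      bulk := fun α β γ => e (C.bulk (e.symm α) (e.symm β) (e.symm γ))
      acc := fun γ => C.acc (e.symm γ)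
      reads := fun γ => C.reads (e.symm γ) }
  refine ⟨C'.diagram, Idx.one, Idx.input, Idx.output, rfl, rfl, rfl, C'.output,
    C'.isFinite_diagram, C'.isGeneratedBy_diagram, nofun, ?_, ?_, ?_⟩
  · intro σ u h0 hedge hbulk
    have h0' : ∀ p, e (u 0 p) = C'.raw σ[p]? := fun p => congrArg e (h0 p)
    have hedge' : ∀ t, e (u (t + 1) 0) = C'.edge (e (u t 0)) (e (u t 1)) := by
      simp [C', hedge]
    have hbulk' : ∀ t p, e (u (t + 1) (p + 1)) =
        C'.bulk (e (u t p)) (e (u t (p + 1))) (e (u t (p + 2))) := by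
      simp [C', hbulk]
    refine ⟨fun τ hacc hread => ?_, fun hacc => ?_⟩
    · exact output_stringSet (u := fun t p => e (u t p)) h0' hedge' hbulk' (by simpa [C'] using hacc)
        (by simpa [C'] using hread)
    · exact output_stringSet_eq_empty (u := fun t p => e (u t p)) h0' hedge' hbulk'
        (by simpa [C'] using hacc)
  · intro s hs
    exact congrFun (eq_solution hs.1 (hs.2 ⟨_, rfl⟩)) Idx.output
  · intro A
    refine ⟨C'.solution A, ⟨isCrossSection_solution A, ?_⟩, rfl⟩
    rintro ⟨_, rfl⟩
    rfl

end CellAut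

/-! ### Turing machines as cellular automata -/

namespace BinaryTM

variable {Q Θ : Type*} (M : BinaryTM Q Θ)

/-- The tape symbol of an entry of a string; `none` stands for the end of the string. -/
def symbol : Option (Fin 2) → Θ
  | none => M.blank
  | some b => M.bit b

theorem symbol_injective : Function.Injective M.symbol := by
  rintro (_ | a) (_ | b) h
  · rfl
  · exact absurd h.symm (M.blank_ne_bit b)
  · exact absurd h (M.blank_ne_bit a)
  · exact congrArg some (M.bit_injective h)

theorem tapeOf_apply (σ : List (Fin 2)) (p : ℕ) : M.tapeOf σ p = M.symbol σ[p]? := by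
  unfold tapeOf
  split_ifs with h
  · simp [h, symbol]
  · simp [not_lt.1 h, symbol]

/-- The machine stops in the state `q`. -/
def Halts (q : Q) : Prop := q = M.accept ∨ q = M.reject

theorem run_succ (σ : List (Fin 2)) (n : ℕ) : M.run σ (n + 1) = M.step (M.run σ n) :=
  Function.iterate_succ_apply' _ _ _

variable {M}

theorem run_add_of_halts {σ : List (Fin 2)} {n : ℕ} (h : M.Halts (M.run σ n).state) (k : ℕ) :
    M.run σ (n + k) = M.run σ n := by
  induction k with
  | zero => rfl
  | succ k ih =>
    rw [← add_assoc, run_succ, ih]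
    exact if_pos h

/-- Consequently all accepting times show the same tape, and no run both accepts and rejects. -/
theorem run_eq_of_halts {σ : List (Fin 2)} {m n : ℕ} (hm : M.Halts (M.run σ m).state)
    (hn : M.Halts (M.run σ n).state) : M.run σ m = M.run σ n := by
  rcases le_total m n with h | h <;> obtain ⟨k, rfl⟩ := Nat.exists_eq_add_of_le h
  · exact (run_add_of_halts hm k).symm
  · exact run_add_of_halts hn k

variable (M)

/-- The contents of the cells of the cellular automaton that simulates a Turing machine: a symbol
that has just been read in, or a symbol and possibly the state of the head at that cell. -/
abbrev Content (Q Θ : Type*) := Θ ⊕ Θ × Option Q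

open Classical in
/-- The symbol after one step. -/
noncomputable def newSymbol : Θ × Option Q → Θ
  | (a, none) => a
  | (a, some q) => if M.Halts q then a else (M.δ (a, q)).1

open Classical in
/-- The state of a head that remains at the cell because the machine has stopped. -/
noncomputable def stays : Θ × Option Q → Option Q
  | (_, none) => none
  | (_, some q) => if M.Halts q then some q else none

open Classical in
/-- The state of a head that moves from the cell in the direction `d`. -/
noncomputable def emits (d : Fin 2) : Content Q Θ → Option Q
  | .inr (a, some q) =>
    if M.Halts q then none else if (M.δ (a, q)).2.2 = d then some (M.δ (a, q)).2.1 else none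
  | _ => none

/-- The cellular automaton that simulates a Turing machine. -/
noncomputable def cellAut : CellAut (Content Q Θ) where
  raw x := .inl (M.symbol x)
  edge
    | .inl a, _ => .inr (a, some M.start)
    | .inr c, γ => .inr (M.newSymbol c, M.stays c <|> M.emits 0 (.inr c) <|> M.emits 0 γ)
  bulk
    | _, .inl a, _ => .inr (a, none)
    | α, .inr c, γ => .inr (M.newSymbol c, M.stays c <|> M.emits 1 α <|> M.emits 0 γ)
  acc
    | .inl _ => False
    | .inr c => c.2 = some M.accept
  reads
    | .inl a, x => a = M.symbol x
    | .inr c, x => c.1 = M.symbol x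

/-- The content of a cell in a configuration. -/
def content (c : Config Q Θ) (p : ℕ) : Content Q Θ :=
  .inr (c.tape p, if p = c.head then some c.state else none)

/-- A head that moves left at cell 0 stays there, hence the term `emits 0 (.inr c)` in the edge
rule. As there is only one head, at most one alternative of the rule is not `none`. -/
theorem content_step_zero (c : Config Q Θ) :
    content (M.step c) 0 = M.cellAut.edge (content c 0) (content c 1) := by
  obtain ⟨T, q, h⟩ := c
  by_cases hq : M.Halts q
  · have : M.step ⟨T, q, h⟩ = ⟨T, q, h⟩ := if_pos hq
    rw [this]
    rcases h with _ | _ | h <;> simp [content, cellAut, newSymbol, stays, emits, hq]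
  · have : ¬ (q = M.accept ∨ q = M.reject) := hq
    obtain hd | hd : (M.δ (T h, q)).2.2 = 0 ∨ (M.δ (T h, q)).2.2 = 1 := by omega
    all_goals rcases h with _ | _ | h <;>
      simp [content, cellAut, newSymbol, stays, emits, hq, step, this, hd]

theorem content_step_succ (c : Config Q Θ) (p : ℕ) :
    content (M.step c) (p + 1) =
      M.cellAut.bulk (content c p) (content c (p + 1)) (content c (p + 2)) := by
  obtain ⟨T, q, h⟩ := c
  by_cases hq : M.Halts q
  · have : M.step ⟨T, q, h⟩ = ⟨T, q, h⟩ := if_pos hq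
    rw [this]
    simp only [content, cellAut]
    split_ifs <;> simp_all [newSymbol, stays, emits]
  · have : ¬ (q = M.accept ∨ q = M.reject) := hq
    obtain hd | hd : (M.δ (T h, q)).2.2 = 0 ∨ (M.δ (T h, q)).2.2 = 1 := by omega
    all_goals
      -- A head outside the window of three cells cannot reach its middle cell in one step.
      obtain rfl | rfl | rfl | ⟨h0, h1, h2⟩ :
        h = p ∨ h = p + 1 ∨ h = p + 2 ∨ (p ≠ h ∧ p + 1 ≠ h ∧ p + 2 ≠ h) := by omega
    all_goals simp [content, cellAut, newSymbol, stays, emits, step, *]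
    all_goals omega

/-- The computation of the cellular automaton that simulates a Turing machine. -/
noncomputable def computation (σ : List (Fin 2)) : ℕ → ℕ → Content Q Θ
  | 0, p => .inl (M.tapeOf σ p)
  | t + 1, p => content (M.run σ t) p

/-- `raw` sees an entry but not its position, so the head cannot be present at time 0. The first
step places it: only cell 0 obeys the edge rule. The automaton therefore lags one step behind the
machine. -/
theorem computation_edge (σ : List (Fin 2)) (t : ℕ) : M.computation σ (t + 1) 0 =
    M.cellAut.edge (M.computation σ t 0) (M.computation σ t 1) := by
  cases t with
  | zero => rfl
  | succ t => simp only [computation, run_succ, content_step_zero]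

theorem computation_bulk (σ : List (Fin 2)) (t p : ℕ) : M.computation σ (t + 1) (p + 1) =
    M.cellAut.bulk (M.computation σ t p) (M.computation σ t (p + 1))
      (M.computation σ t (p + 2)) := by
  cases t with
  | zero => rfl
  | succ t => simp only [computation, run_succ, content_step_succ]

variable {M}

theorem acc_content {c : Config Q Θ} {p : ℕ} :
    M.cellAut.acc (content c p) ↔ p = c.head ∧ c.state = M.accept := by
  simp [content, cellAut]

theorem acc_computation {σ : List (Fin 2)} {t p : ℕ} (h : M.cellAut.acc (M.computation σ t p)) :
    ∃ n, t = n + 1 ∧ (M.run σ n).state = M.accept := by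
  cases t with
  | zero => exact h.elim
  | succ t => exact ⟨t, rfl, (acc_content.1 h).2⟩

end BinaryTM

theorem mainTheorem3 {Q Θ : Type*} [Finite Q] [Finite Θ] (M : BinaryTM Q Θ) :
    ∃ (D : Diagram) (one S T : D.Index) (_ : Fin 1 = D.carrier one)
      (hS : (ℕ × ℕ) = D.carrier S) (hT : (ℕ × ℕ) = D.carrier T)
      (Mbar : Set (D.carrier S) → Set (D.carrier T)),
      D.IsFinite ∧ D.IsGeneratedBy NatMaps ∧ S ≠ T ∧
      (∀ σ : List (Fin 2),
        (∀ τ : List (Fin 2), M.AcceptsLeaving σ τ →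
          Mbar (cast (congrArg Set hS) (stringSet σ)) = cast (congrArg Set hT) (stringSet τ)) ∧
        (M.Rejects σ ∨ M.Diverges σ → Mbar (cast (congrArg Set hS) (stringSet σ)) = ∅)) ∧
      D.RepresentsMap {one} (fun _ => Set.univ) S T Mbar ∧
      (∀ A : Set (D.carrier S), ∃ s ∈ D.crossSections {one} (fun _ => Set.univ), s S = A) := by
  obtain ⟨D, one, S, T, hone, hS, hT, Mbar, hfin, hgen, hne, hM, hrep, hex⟩ :=
    M.cellAut.exists_diagram
  refine ⟨D, one, S, T, hone, hS, hT, Mbar, hfin, hgen, hne, fun σ => ?_, hrep, hex⟩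
  obtain ⟨h1, h2⟩ := hM σ (M.computation σ) (fun p => congrArg Sum.inl (M.tapeOf_apply σ p))
    (M.computation_edge σ) (M.computation_bulk σ)
  refine ⟨?_, fun h => h2 fun t p hacc => ?_⟩
  · rintro τ ⟨n, hn, hτ⟩
    -- Acceptance is signalled at the cell of the head, one time unit late because of the reading-in
    -- step.
    refine h1 τ ⟨n + 1, (M.run σ n).head, BinaryTM.acc_content.2 ⟨rfl, hn⟩⟩ ?_
    intro t q hacc p x
    obtain ⟨m, rfl, hm⟩ := BinaryTM.acc_computation hacc
    have : (M.run σ m).tape p = M.symbol τ[p]? := by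
      rw [BinaryTM.run_eq_of_halts (.inl hm) (.inl hn), hτ, M.tapeOf_apply]
    -- A tape symbol determines the entry as which it is read, since the bits are distinct and
    -- differ from the blank.
    exact (Eq.congr_left this).trans M.symbol_injective.eq_iff
  · obtain ⟨n, rfl, hn⟩ := BinaryTM.acc_computation hacc
    rcases h with ⟨m, hm⟩ | h
    · rw [BinaryTM.run_eq_of_halts (.inl hn) (.inr hm), hm] at hn
      exact M.accept_ne_reject hn.symm
    · exact (h n).1 hn
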